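/- **Theorem (Centralized lower bound).** There is a numerical constant $c>0$ such that the following holds for all integers $M,K,R\ge 1$ and all reals $H,\Delta>0$ and $\sigma,\tau,\zeta\ge 0$ with $\sigma^2\le MKR\,\Delta H$. There are a dimension $d$, differentiable functions $F_1,\dots,F_M:\mathbb{R}^d\to\mathbb{R}$ with average $F=\frac1M\sum_{m}F_m$, probability distributions $\mathcal D_1,\dots,\mathcal D_M$ on a measurable space $\mathcal Z$, and oracle maps $s_z(x)\in\mathbb{R}$, $g_z(x)\in\mathbb{R}^d$ ($z\in\mathcal Z$, $x\in\mathbb{R}^d$) such that, for all $m,n\in[M]$ and $x,y\in\mathbb{R}^d$ (norms are Euclidean, resp. spectral): - ($H$-smoothness) $\|\nabla F_m(x)-\nabla F_m(y)\|\le H\|x-y\|$; - (bounded sub-optimality) $F(0)-\inf F\le\Delta$; - (second-order heterogeneity) the $F_m$ are twice differentiable and $\|\nabla^2F_m(x)-\nabla^2F_n(x)\|\le\tau$; - (first-order heterogeneity) $\|\nabla F_m(x)-\nabla F_n(x)\|\le H\zeta$; - (stochastic oracle) $\mathbb{E}_{z\sim\mathcal D_m}[s_z(x)]=F_m(x)$,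 $\mathbb{E}_{z\sim\mathcal D_m}[g_z(x)]=\nabla F_m(x)$, $\mathbb{E}_{z\sim\mathcal D_m}\|g_z(x)-\nabla F_m(x)\|^2\le\sigma^2$ and $\mathbb{E}_{z\sim\mathcal D_m}\|g_z(x)-g_z(y)\|^2\le H^2\|x-y\|^2$; and such that every centralized distributed zero-respecting algorithm with $R$ communication rounds and $K$ two-point oracle calls per machine and round has an output $x_R$ satisfying $$\mathbb{E}\,\|\nabla F(x_R)\|^2\;\ge\;c\left(\frac{\Delta H}{R}+\frac{\sigma^2}{MKR}+\Big(\frac{\sigma\Delta H}{MKR}\Big)^{2/3}\right).$$ Here a two-point oracle call on machine $m$ at a pair $(x,y)$ draws a fresh independent $z\sim\mathcal D_m$ and returns $(s_z(x),s_z(y),g_z(x),g_z(y))$. In each round every machine makes $K$ successive calls, and at the end of the round all answers are shared. An algorithm chooses each query of a machine by a deterministic rule, the same for all machines, from all answers on all machines in earlier rounds and that machine's own answers in the current round; the output is a function of all answers of the $R$ rounds and possibly of an independent random seed. It is *zero-respecting* if each queried point is nonzero only on coordinates on which some gradient estimate in the answers available to that query is nonzero (so the first query is at $0$), and the output is nonzero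 only on coordinates on which some gradient estimate received on any machine is nonzero. It is *centralized* if all queries of all machines within a round are the same pair of points. -/

import Mathlib

open MeasureTheory

/-- Euclidean space `ℝᵈ`. -/
abbrev Pt (d : ℕ) : Type := EuclideanSpace ℝ (Fin d)

/-- The coordinate support of a vector. -/
def coordSupport {d : ℕ} (v : Pt d) : Set (Fin d) := {i | v i ≠ 0}

/-- A two-point query: the two points at which the oracle is to be evaluated on one common datum. -/
abbrev Query (d : ℕ) : Type := Pt d × Pt d

/-- The answer of a two-point first-order oracle to a query `(x, y)`: function values and gradient
estimates at `x` and at `y`, all computed from the same random datum. -/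
structure Answer (d : ℕ) where
  valFst : ℝ
  valSnd : ℝ
  gradFst : Pt d
  gradSnd : Pt d

/-- The coordinates revealed by an answer: those on which one of its gradient estimates is nonzero. -/
def Answer.support {d : ℕ} (a : Answer d) : Set (Fin d) :=
  coordSupport a.gradFst ∪ coordSupport a.gradSnd

/-- A distributed problem on `M` machines together with its stochastic first-order oracles.
Machine `m` has the objective `F m` and the data distribution `D m`; on the datum `z` the oracle
reports at `x` the function value `s z x` and the gradient estimate `g z x`. -/
structure ProblemInstance (d M : ℕ) where
  Z : Type
  measZ : MeasurableSpace Z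
  D : Fin M → Measure Z
  probD : ∀ m, IsProbabilityMeasure (D m)
  F : Fin M → Pt d → ℝ
  s : Z → Pt d → ℝ
  g : Z → Pt d → Pt d

attribute [instance] ProblemInstance.measZ ProblemInstance.probD

namespace ProblemInstance

variable {d M : ℕ}

/-- The average objective `F = (1/M) ∑ₘ Fₘ`. -/
noncomputable def avg (P : ProblemInstance d M) (x : Pt d) : ℝ := (1 / (M : ℝ)) * ∑ m, P.F m x

/-- The oracle's answer to the two-point query `q` on the datum `z`. -/
def answer (P : ProblemInstance d M) (z : P.Z) (q : Query d) : Answer d where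
  valFst := P.s z q.1
  valSnd := P.s z q.2
  gradFst := P.g z q.1
  gradSnd := P.g z q.2

/-- Second-order smoothness: every `Fₘ` is differentiable with `H`-Lipschitz gradient. -/
def Smooth (P : ProblemInstance d M) (H : ℝ) : Prop :=
  ∀ m, Differentiable ℝ (P.F m) ∧
    ∀ x y, ‖gradient (P.F m) x - gradient (P.F m) y‖ ≤ H * ‖x - y‖

/-- Bounded function sub-optimality: `F(0) - inf F ≤ Δ`. -/
def BoundedSubopt (P : ProblemInstance d M) (Δ : ℝ) : Prop :=
  ∀ x, P.avg 0 - P.avg x ≤ Δ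

/-- Bounded second-order heterogeneity: the `Fₘ` are twice differentiable and
`‖∇²Fₘ(x) - ∇²Fₙ(x)‖ ≤ τ` in operator norm, for all `m`, `n` and `x`. -/
def BoundedSecondHet (P : ProblemInstance d M) (τ : ℝ) : Prop :=
  (∀ m, Differentiable ℝ (gradient (P.F m))) ∧
    ∀ m n x, ‖fderiv ℝ (gradient (P.F m)) x - fderiv ℝ (gradient (P.F n)) x‖ ≤ τ

/-- Uniformly bounded first-order heterogeneity: `‖∇Fₘ(x) - ∇Fₙ(x)‖ ≤ H ζ`. -/
def BoundedFirstHet (P : ProblemInstance d M) (H ζ : ℝ) : Prop :=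
  ∀ m n x, ‖gradient (P.F m) x - gradient (P.F n) x‖ ≤ H * ζ

/-- The requirements on the stochastic multi-point oracle: unbiased function values, unbiased
gradient estimates, variance at most `σ²`, and `H`-mean-squared smoothness of the estimates. -/
structure OracleConditions (P : ProblemInstance d M) (H σ : ℝ) : Prop where
  val_integrable : ∀ m x, Integrable (fun z => P.s z x) (P.D m)
  val_unbiased : ∀ m x, ∫ z, P.s z x ∂(P.D m) = P.F m x
  grad_integrable : ∀ m x, Integrable (fun z => P.g z x) (P.D m)
  grad_unbiased : ∀ m x, ∫ z, P.g z x ∂(P.D m) = gradient (P.F m) x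
  variance_integrable : ∀ m x,
    Integrable (fun z => ‖P.g z x - gradient (P.F m) x‖ ^ 2) (P.D m)
  variance_le : ∀ m x, ∫ z, ‖P.g z x - gradient (P.F m) x‖ ^ 2 ∂(P.D m) ≤ σ ^ 2
  meanSq_integrable : ∀ m x y, Integrable (fun z => ‖P.g z x - P.g z y‖ ^ 2) (P.D m)
  meanSq_smooth : ∀ m x y,
    ∫ z, ‖P.g z x - P.g z y‖ ^ 2 ∂(P.D m) ≤ H ^ 2 * ‖x - y‖ ^ 2

/-- The law of the data used in `R` rounds of `K` oracle calls on each machine: all draws are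
independent, and those of machine `m` have law `D m`. -/
noncomputable def sampleLaw (P : ProblemInstance d M) (K R : ℕ) :
    Measure (Fin R → Fin K → Fin M → P.Z) :=
  Measure.pi fun _ => Measure.pi fun _ => Measure.pi P.D

end ProblemInstance

/-- The record of the completed rounds, in order: in each of them, every machine's list of answers. -/
abbrev History (d M : ℕ) : Type := List (Fin M → List (Answer d))

/-- The coordinates revealed by a list of answers of one machine. -/
def ownRevealed {d : ℕ} (own : List (Answer d)) : Set (Fin d) :=
  {i | ∃ a ∈ own, i ∈ a.support}

/-- The coordinates revealed by all answers, on all machines, in the completed rounds. -/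
def pastRevealed {d M : ℕ} (past : History d M) : Set (Fin d) :=
  {i | ∃ round ∈ past, ∃ m, ∃ a ∈ round m, i ∈ a.support}

/-- An algorithm in the intermittent communication model with `M` machines. The next query of a
machine is a deterministic function, the same for all machines, of all answers on all machines in
the completed rounds and of the machine's own answers in the current round. The final output is
computed from all answers and, possibly, a random seed in `Ω` independent of the data. -/
structure DistAlgorithm (d M : ℕ) (Ω : Type) where
  query : History d M → List (Answer d) → Query d
  output : Ω → History d M → Pt d

namespace DistAlgorithm

variable {d M : ℕ} {Ω : Type}

/-- Distributed zero-respecting algorithms: queried points are nonzero only on coordinates revealed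
to the querying machine, and the output, which is the vector communicated in the last round, only
on coordinates revealed on some machine. (The first query is therefore at the origin.) -/
structure ZeroRespecting (A : DistAlgorithm d M Ω) : Prop where
  query_fst : ∀ past own,
    coordSupport (A.query past own).1 ⊆ ownRevealed own ∪ pastRevealed past
  query_snd : ∀ past own,
    coordSupport (A.query past own).2 ⊆ ownRevealed own ∪ pastRevealed past
  output : ∀ θ past, coordSupport (A.output θ past) ⊆ pastRevealed past

/-- Centralized algorithms: within a round, all queries on all machines are the same. -/
def Centralized (A : DistAlgorithm d M Ω) : Prop :=
  ∀ past own own', A.query past own = A.query past own'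

/-- The answers one machine receives in a round, calling its oracle successively on the data
`z 0, …, z (K - 1)`. -/
def machineRound (A : DistAlgorithm d M Ω) (P : ProblemInstance d M) {K : ℕ}
    (past : History d M) (z : Fin K → P.Z) : List (Answer d) :=
  (List.ofFn z).foldl (fun own zk => own ++ [P.answer zk (A.query past own)]) []

/-- The record of all `R` rounds, where machine `m` uses the datum `ω r k m` in its `k`-th call of
round `r`. -/
def transcript (A : DistAlgorithm d M Ω) (P : ProblemInstance d M) {K R : ℕ}
    (ω : Fin R → Fin K → Fin M → P.Z) : History d M :=
  (List.ofFn ω).foldl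
    (fun past zr => past ++ [fun m => A.machineRound P past fun k => zr k m]) []

/-- The expected squared gradient norm `𝔼 ‖∇F(x_R)‖²` of the output after `R` rounds with `K` oracle
calls per machine and round, over the data and the seed, as an extended nonnegative number. -/
noncomputable def expectedSqGrad [MeasurableSpace Ω] (A : DistAlgorithm d M Ω)
    (μ : Measure Ω) (P : ProblemInstance d M) (K R : ℕ) : ENNReal :=
  ∫⁻ p, ENNReal.ofReal (‖gradient P.avg (A.output p.1 (A.transcript P p.2))‖ ^ 2)
    ∂(μ.prod (P.sampleLaw K R))

end DistAlgorithm

/-!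
All machines get the same objective, a zero-chain: at a point supported on the first `k`
coordinates its gradient reveals at most one new coordinate, and the gradient is bounded below at
every point that does not involve all `d` coordinates. The oracle multiplies the part of the
gradient responsible for the new coordinate by a variable that is `p⁻¹` with probability `p` and
`0` otherwise. Since all queries of a centralized round are at the same two points, which depend on
earlier rounds only, a round reveals at most one coordinate, and none unless one of its `M * K`
draws is nonzero. By Markov's inequality the coordinates are not all found with probability at
least `1 / 2` as soon as `R < d` or `2 * M * K * R * p ≤ d`.

The noise must be Lipschitz and bounded uniformly in `d`, so it cannot simply be the new coordinate
of the gradient. With activation levels `s (x j)` for a smooth step `s`, its coordinates are the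
decrements of the tail maxima of these levels: they telescope, and so do the Lipschitz estimates,
because the map `(a, m) ↦ (max a m, min a m)` is nonexpansive.

The three terms come from three scalings. With `p = 1` and `d = R + 1` one obtains `Δ * H / R`; a
one-dimensional quadratic with `p = 1 / (2 * M * K * R)` gives the variance term. For the last term
let `u` be the cube root of `σ * Δ * H / (M * K * R)`; the chain is run with gradients of size about
`u`, `p` about `(u / σ) ^ 2` and `d` about `2 * M * K * R * p`. If the last term is the largest of
the three, then `u ≤ σ` and `M * K * R * (u / σ) ^ 2 ≥ 1`.
-/

/-! ### Progress of a centralized algorithm on a zero-chain -/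

/-- The coordinates of index less than `k`; a zero-chain reveals coordinates in this order. -/
def firstCoords (d k : ℕ) : Set (Fin d) := {i | (i : ℕ) < k}

theorem firstCoords_mono {d : ℕ} : Monotone (firstCoords d) :=
  fun _ _ hkl _ hi => lt_of_lt_of_le hi hkl

theorem coordSupport_subset_firstCoords_iff {d k : ℕ} {x : Pt d} :
    coordSupport x ⊆ firstCoords d k ↔ ∀ i : Fin d, k ≤ i → x i = 0 := by
  simp only [Set.subset_def, coordSupport, firstCoords, Set.mem_ofPred_eq]
  exact forall_congr' fun i => by rw [← not_le, ne_eq, not_imp_not]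

theorem DistAlgorithm.Centralized.machineRound_eq {d M K : ℕ} {Ω : Type}
    {A : DistAlgorithm d M Ω} (hC : A.Centralized) (P : ProblemInstance d M)
    (past : History d M) (z : Fin K → P.Z) :
    A.machineRound P past z = (List.ofFn z).map fun zk => P.answer zk (A.query past []) := by
  have foldl_eq (l : List P.Z) (own : List (Answer d)) :
      l.foldl (fun own zk => own ++ [P.answer zk (A.query past own)]) own
        = own ++ l.map fun zk => P.answer zk (A.query past []) := by
    induction l generalizing own with
    | nil => simp
    | cons zk l ih => simp [ih, hC past own []]
  simp [DistAlgorithm.machineRound, foldl_eq]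

/-- The event that, in a single round, some machine draws a datum in `S`. -/
def activeRound {Z : Type*} {K M : ℕ} (S : Set Z) : Set (Fin K → Fin M → Z) :=
  {z | ∃ k m, z k m ∈ S}

/-- The number of rounds in which some machine draws a datum in `S`. -/
noncomputable def activeRounds {Z : Type*} {R K M : ℕ} (S : Set Z)
    (ω : Fin R → Fin K → Fin M → Z) : ℕ :=
  ∑ r, (activeRound S).indicator 1 (ω r)

theorem activeRounds_le {Z : Type*} {R K M : ℕ} (S : Set Z) (ω : Fin R → Fin K → Fin M → Z) :
    activeRounds S ω ≤ R := by
  calc activeRounds S ω ≤ ∑ _r : Fin R, 1 :=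
        Finset.sum_le_sum fun r _ => Set.indicator_le_self _ _ _
    _ = R := by simp

theorem measurableSet_activeRound {Z : Type*} [MeasurableSpace Z] {K M : ℕ} {S : Set Z}
    (hS : MeasurableSet S) : MeasurableSet (activeRound S : Set (Fin K → Fin M → Z)) := by
  simp only [activeRound, Set.ofPred_exists]
  exact .iUnion fun k => .iUnion fun m => measurableSet_preimage (by fun_prop) hS

theorem measurable_activeRounds {Z : Type*} [MeasurableSpace Z] {R K M : ℕ} {S : Set Z}
    (hS : MeasurableSet S) : Measurable (activeRounds (R := R) (K := K) (M := M) S) :=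
  Finset.measurable_sum _ fun r _ =>
    (measurable_one.indicator (measurableSet_activeRound hS)).comp (measurable_pi_apply r)

theorem measurableSet_activeRounds_lt {Z : Type*} [MeasurableSpace Z] {R K M : ℕ} {S : Set Z}
    (hS : MeasurableSet S) (l : ℕ) :
    MeasurableSet {ω : Fin R → Fin K → Fin M → Z | activeRounds S ω < l} :=
  measurable_activeRounds hS measurableSet_Iio

namespace ProblemInstance

variable {d M : ℕ} {P : ProblemInstance d M} {S : Set P.Z}

/-- A stochastic zero-chain: at a point supported on the first `k` coordinates a gradient estimate
reveals at most coordinate `k`, and it does so only on the data in `S`. -/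
structure IsZeroChain (P : ProblemInstance d M) (S : Set P.Z) : Prop where
  coordSupport_g_subset : ∀ z k x,
    coordSupport x ⊆ firstCoords d k → coordSupport (P.g z x) ⊆ firstCoords d (k + 1)
  coordSupport_g_subset_of_notMem : ∀ z ∉ S, ∀ k x,
    coordSupport x ⊆ firstCoords d k → coordSupport (P.g z x) ⊆ firstCoords d k

variable {K R : ℕ} {Ω : Type} {A : DistAlgorithm d M Ω}

theorem IsZeroChain.pastRevealed_append_subset (hP : P.IsZeroChain S) (hZ : A.ZeroRespecting)
    (hC : A.Centralized) {past : History d M} {l : ℕ}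
    (hpast : pastRevealed past ⊆ firstCoords d l) (z : Fin K → Fin M → P.Z) :
    pastRevealed (past ++ [fun m => A.machineRound P past fun k => z k m])
      ⊆ firstCoords d (l + (activeRound S).indicator 1 z) := by
  rintro i ⟨round, hround, m, a, ha, hi⟩
  rcases List.mem_append.1 hround with hround | hround
  · exact firstCoords_mono (Nat.le_add_right _ _) (hpast ⟨round, hround, m, a, ha, hi⟩)
  obtain rfl := List.mem_singleton.1 hround
  beta_reduce at ha
  rw [hC.machineRound_eq, List.mem_map] at ha
  obtain ⟨_, hk, rfl⟩ := ha
  obtain ⟨k, rfl⟩ := List.mem_ofFn.1 hk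
  have query_subset {x : Pt d} (hx : coordSupport x ⊆ ownRevealed [] ∪ pastRevealed past) :
      coordSupport x ⊆ firstCoords d l := hx.trans (by simpa [ownRevealed] using hpast)
  have g_subset (x : Pt d) (hx : coordSupport x ⊆ firstCoords d l) :
      coordSupport (P.g (z k m) x) ⊆ firstCoords d (l + (activeRound S).indicator 1 z) := by
    by_cases hz : z ∈ activeRound S
    · simpa [hz] using hP.coordSupport_g_subset _ _ _ hx
    · simpa [hz] using hP.coordSupport_g_subset_of_notMem _ (fun h => hz ⟨k, m, h⟩) _ _ hx
  exact hi.elim (fun h => g_subset _ (query_subset (hZ.query_fst past [])) h)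
    fun h => g_subset _ (query_subset (hZ.query_snd past [])) h

theorem IsZeroChain.pastRevealed_transcript_subset (hP : P.IsZeroChain S)
    (hZ : A.ZeroRespecting) (hC : A.Centralized) (ω : Fin R → Fin K → Fin M → P.Z) :
    pastRevealed (A.transcript P ω) ⊆ firstCoords d (activeRounds S ω) := by
  have foldl_subset (rounds : List (Fin K → Fin M → P.Z)) (past : History d M) (l : ℕ)
      (hpast : pastRevealed past ⊆ firstCoords d l) :
      pastRevealed (rounds.foldl (fun past z => past ++ [fun m =>
        A.machineRound P past fun k => z k m]) past)
        ⊆ firstCoords d (l + (rounds.map ((activeRound S).indicator 1)).sum) := by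
    induction rounds generalizing past l with
    | nil => simpa using hpast
    | cons z rounds ih =>
      rw [List.map_cons, List.sum_cons, ← add_assoc]
      exact ih _ _ (hP.pastRevealed_append_subset hZ hC hpast z)
  have := foldl_subset (List.ofFn ω) [] 0 (by simp [pastRevealed])
  rwa [List.map_ofFn, List.sum_ofFn, zero_add] at this

instance (P : ProblemInstance d M) (K R : ℕ) : IsProbabilityMeasure (P.sampleLaw K R) := by
  unfold sampleLaw; infer_instance

theorem measurePreserving_eval (P : ProblemInstance d M) (r : Fin R) (k : Fin K) (m : Fin M) :
    MeasurePreserving (fun ω => ω r k m) (P.sampleLaw K R) (P.D m) :=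
  ((MeasureTheory.measurePreserving_eval P.D m).comp
    (MeasureTheory.measurePreserving_eval (fun _ : Fin K => Measure.pi P.D) k)).comp
    (MeasureTheory.measurePreserving_eval
      (fun _ : Fin R => Measure.pi fun _ : Fin K => Measure.pi P.D) r)

theorem sampleLaw_activeRound_le (hS : MeasurableSet S) (r : Fin R) :
    P.sampleLaw K R {ω | ω r ∈ activeRound S} ≤ K * ∑ m, P.D m S := by
  have union : {ω : Fin R → Fin K → Fin M → P.Z | ω r ∈ activeRound S}
      = ⋃ k, ⋃ m, (fun ω => ω r k m) ⁻¹' S := by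
    ext ω; simp [activeRound]
  calc P.sampleLaw K R {ω | ω r ∈ activeRound S}
      ≤ ∑ k : Fin K, ∑ m, P.sampleLaw K R ((fun ω => ω r k m) ⁻¹' S) := by
        rw [union]
        refine (measure_iUnion_fintype_le _ _).trans (Finset.sum_le_sum fun k _ => ?_)
        exact measure_iUnion_fintype_le _ _
    _ = K * ∑ m, P.D m S := by
        simp [(P.measurePreserving_eval _ _ _).measure_preimage hS.nullMeasurableSet]

theorem lintegral_activeRounds_le (hS : MeasurableSet S) :
    ∫⁻ ω, activeRounds S ω ∂(P.sampleLaw K R) ≤ R * (K * ∑ m, P.D m S) := by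
  have meas (r : Fin R) :
      MeasurableSet {ω : Fin R → Fin K → Fin M → P.Z | ω r ∈ activeRound S} :=
    measurable_pi_apply r (measurableSet_activeRound hS)
  calc ∫⁻ ω, activeRounds S ω ∂(P.sampleLaw K R)
      = ∫⁻ ω, ∑ r, {ω : Fin R → Fin K → Fin M → P.Z | ω r ∈ activeRound S}.indicator 1 ω
          ∂(P.sampleLaw K R) := by
        classical simp [activeRounds, Set.indicator_apply]
    _ = ∑ r : Fin R, P.sampleLaw K R {ω | ω r ∈ activeRound S} := by
        rw [lintegral_finsetSum _ fun r _ => measurable_one.indicator (meas r)]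
        simp_rw [lintegral_indicator_one (meas _)]
    _ ≤ R * (K * ∑ m, P.D m S) := by
        simpa using Finset.sum_le_card_nsmul Finset.univ _ _
          fun r _ => sampleLaw_activeRound_le (K := K) hS r

theorem half_le_sampleLaw_activeRounds_lt (hS : MeasurableSet S) {l : ℕ} (hl : l ≠ 0)
    (h : R < l ∨ 2 * (R * (K * ∑ m, P.D m S)) ≤ l) :
    1 / 2 ≤ P.sampleLaw K R {ω | activeRounds S ω < l} := by
  rcases h with hR | hp
  · simp [fun ω : Fin R → Fin K → Fin M → P.Z => (activeRounds_le S ω).trans_lt hR]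
  have markov : P.sampleLaw K R {ω | activeRounds S ω < l}ᶜ ≤ 1 / 2 := by
    calc P.sampleLaw K R {ω | activeRounds S ω < l}ᶜ
        = P.sampleLaw K R {ω | (l : ENNReal) ≤ activeRounds S ω} := by
          congr 1; ext ω; simp
      _ ≤ (∫⁻ ω, activeRounds S ω ∂(P.sampleLaw K R)) / l :=
          meas_ge_le_lintegral_div
            (measurable_from_top.comp (measurable_activeRounds hS)).aemeasurable
            (by exact_mod_cast hl) (ENNReal.natCast_ne_top l)
      _ ≤ 1 / 2 := by
          rw [ENNReal.div_le_iff (by exact_mod_cast hl) (ENNReal.natCast_ne_top l), mul_comm,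
            mul_one_div, ENNReal.le_div_iff_mul_le (by simp) (by simp), mul_comm]
          exact le_trans (by gcongr; exact lintegral_activeRounds_le hS) hp
  rw [prob_compl_eq_one_sub (measurableSet_activeRounds_lt hS l), tsub_le_iff_left] at markov
  refine (ENNReal.add_le_add_iff_right (a := 1 / 2) (by simp)).1 ?_
  rwa [ENNReal.add_halves]

theorem IsZeroChain.le_expectedSqGrad (hP : P.IsZeroChain S) (hS : MeasurableSet S)
    (hd : d ≠ 0) (h : R < d ∨ 2 * (R * (K * ∑ m, P.D m S)) ≤ d) {ε : ℝ}
    (hε : ∀ k < d, ∀ x, coordSupport x ⊆ firstCoords d k → ε ≤ ‖gradient P.avg x‖ ^ 2)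
    [MeasurableSpace Ω] (μ : Measure Ω) [IsProbabilityMeasure μ]
    (hZ : A.ZeroRespecting) (hC : A.Centralized) :
    ENNReal.ofReal (ε / 2) ≤ A.expectedSqGrad μ P K R := by
  set U : Set (Ω × (Fin R → Fin K → Fin M → P.Z)) := {q | activeRounds S q.2 < d}
  have hU : MeasurableSet U :=
    measurable_snd (measurableSet_activeRounds_lt hS d)
  have half_le : 1 / 2 ≤ μ.prod (P.sampleLaw K R) U := by
    refine (half_le_sampleLaw_activeRounds_lt hS hd h).trans_eq ?_
    exact (measurePreserving_snd.measure_preimage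
      (measurableSet_activeRounds_lt hS d).nullMeasurableSet).symm
  calc ENNReal.ofReal (ε / 2) = ENNReal.ofReal ε * (1 / 2) := by
        rw [ENNReal.ofReal_div_of_pos two_pos]; simp [div_eq_mul_inv]
    _ ≤ ENNReal.ofReal ε * μ.prod (P.sampleLaw K R) U := by gcongr
    _ = ∫⁻ _ in U, ENNReal.ofReal ε ∂(μ.prod (P.sampleLaw K R)) := by
        rw [setLIntegral_const]
    _ ≤ ∫⁻ q in U, ENNReal.ofReal (‖gradient P.avg (A.output q.1 (A.transcript P q.2))‖ ^ 2)
          ∂(μ.prod (P.sampleLaw K R)) :=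
        setLIntegral_mono' hU fun q hq => ENNReal.ofReal_le_ofReal <| hε _ hq _ <|
          (hZ.output _ _).trans (hP.pastRevealed_transcript_subset hZ hC q.2)
    _ ≤ A.expectedSqGrad μ P K R := setLIntegral_le_lintegral _ _

end ProblemInstance

/-! ### A gradient oracle with Bernoulli noise -/

section NoisyOracle

open ProbabilityTheory

/-- The law of a datum `z` that equals `p⁻¹` with probability `p` and `0` otherwise: it has mean
`1`, and is mostly `0` if `p` is small. -/
noncomputable abbrev sparseLaw (p : unitInterval) : Measure ℝ := bernoulliMeasure (p : ℝ)⁻¹ 0 p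

theorem sparseLaw_compl_zero {p : unitInterval} (hp : 0 < p) :
    sparseLaw p {0}ᶜ = ENNReal.ofReal p := by
  rw [bernoulliMeasure_apply_of_mem_of_notMem p (measurableSet_singleton 0).compl
    (by simp [hp.ne']) (by simp), ← ENNReal.ofReal_coe_nnreal]
  rfl

theorem integral_add_smul_sparseLaw {E : Type*} [NormedAddCommGroup E] [NormedSpace ℝ E]
    [CompleteSpace E] {p : unitInterval} (hp : 0 < p) (u v : E) :
    ∫ z : ℝ, u + (z - 1) • v ∂(sparseLaw p) = u := by
  have hp' : (p : ℝ) ≠ 0 := ne_of_gt hp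
  rw [integral_bernoulliMeasure]
  match_scalars <;> field_simp <;> ring

theorem integral_norm_add_smul_sq_sparseLaw {E : Type*} [NormedAddCommGroup E]
    [InnerProductSpace ℝ E] {p : unitInterval} (hp : 0 < p) (u v : E) :
    ∫ z : ℝ, ‖u + (z - 1) • v‖ ^ 2 ∂(sparseLaw p)
      = ‖u‖ ^ 2 + (1 - p) / p * ‖v‖ ^ 2 := by
  have hp' : (p : ℝ) ≠ 0 := ne_of_gt hp
  rw [integral_bernoulliMeasure]
  simp only [norm_add_sq_real, inner_smul_right, norm_smul, mul_pow, Real.norm_eq_abs, sq_abs,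
    smul_eq_mul]
  field_simp
  ring

/-- The homogeneous problem in which every machine has the objective `f` with gradient `G`, exact
function values, and the gradient estimate `G x + (z - 1) • n x` on a sparse datum `z`. -/
noncomputable abbrev noisyInstance {d : ℕ} (M : ℕ) (p : unitInterval) (f : Pt d → ℝ)
    (G n : Pt d → Pt d) : ProblemInstance d M where
  Z := ℝ
  measZ := inferInstance
  D := fun _ => sparseLaw p
  probD := inferInstance
  F := fun _ => f
  s := fun _ => f
  g := fun z x => G x + (z - 1) • n x

/-- The pairs of a gradient map and a noise map for which `noisyInstance` is a zero-chain: the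
estimate `G x - n x` on the datum `0` reveals no new coordinate. -/
structure IsNoisyChain {d : ℕ} (G n : Pt d → Pt d) : Prop where
  noise : ∀ k x, coordSupport x ⊆ firstCoords d k → coordSupport (n x) ⊆ firstCoords d (k + 1)
  sub : ∀ k x, coordSupport x ⊆ firstCoords d k → coordSupport (G x - n x) ⊆ firstCoords d k

variable {d M : ℕ} {p : unitInterval} {f : Pt d → ℝ} {G n : Pt d → Pt d}

theorem avg_noisyInstance (hM : M ≠ 0) : (noisyInstance M p f G n).avg = f := by
  funext x
  simp [ProblemInstance.avg, hM]

theorem oracleConditions_noisyInstance {H σ : ℝ} (hp : 0 < p)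
    (hG : ∀ x, HasGradientAt f (G x) x) (hvar : ∀ x, (1 - p) / p * ‖n x‖ ^ 2 ≤ σ ^ 2)
    (hms : ∀ x y, ‖G x - G y‖ ^ 2 + (1 - p) / p * ‖n x - n y‖ ^ 2 ≤ H ^ 2 * ‖x - y‖ ^ 2) :
    (noisyInstance M p f G n).OracleConditions H σ where
  val_integrable _ _ := integrable_bernoulliMeasure _ _ _ _
  val_unbiased _ x := by simp [noisyInstance]
  grad_integrable _ _ := integrable_bernoulliMeasure _ _ _ _
  grad_unbiased _ x := by
    rw [(hG x).gradient]; exact integral_add_smul_sparseLaw hp _ _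
  variance_integrable _ _ := integrable_bernoulliMeasure _ _ _ _
  variance_le _ x := by
    simpa [(hG x).gradient] using
      (integral_norm_add_smul_sq_sparseLaw hp 0 (n x)).trans_le (by simpa using hvar x)
  meanSq_integrable _ _ _ := integrable_bernoulliMeasure _ _ _ _
  meanSq_smooth _ x y := by
    have difference (z : ℝ) : G x + (z - 1) • n x - (G y + (z - 1) • n y)
        = (G x - G y) + (z - 1) • (n x - n y) := by module
    simp only [difference]
    exact (integral_norm_add_smul_sq_sparseLaw hp _ _).trans_le (hms x y)

theorem IsNoisyChain.isZeroChain_noisyInstance (h : IsNoisyChain G n) :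
    (noisyInstance M p f G n).IsZeroChain {(0 : ℝ)}ᶜ where
  coordSupport_g_subset z k x hx := by
    have hn := coordSupport_subset_firstCoords_iff.1 (h.noise k x hx)
    have hsub := coordSupport_subset_firstCoords_iff.1 (h.sub k x hx)
    refine coordSupport_subset_firstCoords_iff.2 fun i hi => ?_
    have hGi : G x i = n x i := by
      simpa [sub_eq_zero] using hsub i ((Nat.le_succ k).trans hi)
    simp [hGi, hn i hi]
  coordSupport_g_subset_of_notMem z hz k x hx := by
    obtain rfl : z = (0 : ℝ) := not_not.1 hz
    have : (noisyInstance M p f G n).g (0 : ℝ) x = G x - n x := by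
      simp [sub_eq_add_neg]
    exact this ▸ h.sub k x hx

end NoisyOracle

/-- `HardInstance M K R H Δ σ τ ζ ε`: some problem satisfying all the requirements of the lower
bound forces every centralized zero-respecting algorithm to have an expected squared gradient norm
of at least `ε`. -/
def HardInstance (M K R : ℕ) (H Δ σ τ ζ ε : ℝ) : Prop :=
  ∃ (d : ℕ) (P : ProblemInstance d M),
    P.Smooth H ∧ P.BoundedSubopt Δ ∧ P.BoundedSecondHet τ ∧ P.BoundedFirstHet H ζ ∧
    P.OracleConditions H σ ∧
    ∀ (Ω : Type) [MeasurableSpace Ω] (μ : Measure Ω) [IsProbabilityMeasure μ]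
      (A : DistAlgorithm d M Ω), A.ZeroRespecting → A.Centralized →
      ENNReal.ofReal ε ≤ A.expectedSqGrad μ P K R

theorem HardInstance.mono {M K R : ℕ} {H Δ σ τ ζ ε ε' : ℝ}
    (h : HardInstance M K R H Δ σ τ ζ ε) (hε : ε' ≤ ε) : HardInstance M K R H Δ σ τ ζ ε' := by
  obtain ⟨d, P, hS, hB, hτ, hζ, hO, hP⟩ := h
  exact ⟨d, P, hS, hB, hτ, hζ, hO, fun Ω _ μ _ A hZ hC =>
    (ENNReal.ofReal_le_ofReal hε).trans (hP Ω μ A hZ hC)⟩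

theorem IsNoisyChain.hardInstance {d M K R : ℕ} {H Δ σ τ ζ ε : ℝ} {p : unitInterval}
    {f : Pt d → ℝ} {G n : Pt d → Pt d} (h : IsNoisyChain G n) (hM : M ≠ 0) (hd : d ≠ 0)
    (hH : 0 ≤ H) (hτ : 0 ≤ τ) (hζ : 0 ≤ ζ) (hp : 0 < p)
    (hG : ∀ x, HasGradientAt f (G x) x) (hGd : Differentiable ℝ G) (hΔ : ∀ x, f 0 - f x ≤ Δ)
    (hvar : ∀ x, (1 - p) / p * ‖n x‖ ^ 2 ≤ σ ^ 2)
    (hms : ∀ x y, ‖G x - G y‖ ^ 2 + (1 - p) / p * ‖n x - n y‖ ^ 2 ≤ H ^ 2 * ‖x - y‖ ^ 2)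
    (hε : ∀ k < d, ∀ x, coordSupport x ⊆ firstCoords d k → ε ≤ ‖G x‖ ^ 2)
    (hactive : R < d ∨ 2 * (M * K * R * p : ℝ) ≤ d) :
    HardInstance M K R H Δ σ τ ζ (ε / 2) := by
  have hgrad : gradient f = G := gradient_eq hG
  have gradF (m : Fin M) : gradient ((noisyInstance M p f G n).F m) = G := hgrad
  refine ⟨d, noisyInstance M p f G n, fun m => ⟨fun x => (hG x).differentiableAt, fun x y => ?_⟩,
    fun x => ?_, ⟨fun m => ?_, fun m m' x => ?_⟩, fun m m' x => ?_,
    oracleConditions_noisyInstance hp hG hvar hms, fun Ω _ μ _ A hZ hC => ?_⟩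
  · have noise_nonneg : 0 ≤ (1 - p : ℝ) / p * ‖n x - n y‖ ^ 2 :=
      mul_nonneg (div_nonneg (sub_nonneg.2 p.2.2) p.2.1) (sq_nonneg _)
    rw [gradF]
    refine le_of_sq_le_sq ?_ (by positivity)
    linarith [hms x y, mul_pow H ‖x - y‖ 2]
  · rw [avg_noisyInstance hM]; exact hΔ x
  · rwa [gradF]
  · simpa [gradF] using hτ
  · simpa [gradF] using mul_nonneg hH hζ
  · refine h.isZeroChain_noisyInstance.le_expectedSqGrad (measurableSet_singleton _).compl hd
      (hactive.imp_right fun hle => ?_) ?_ μ hZ hC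
    · simp only [sparseLaw_compl_zero hp]
      have total : 2 * (R * (K * ∑ _m : Fin M, ENNReal.ofReal p))
          = ENNReal.ofReal (2 * (M * K * R * p)) := by
        simp only [Finset.sum_const, Finset.card_univ, Fintype.card_fin, nsmul_eq_mul]
        rw [ENNReal.ofReal_mul two_pos.le, ENNReal.ofReal_mul (by positivity), ← Nat.cast_mul,
          ← Nat.cast_mul, ENNReal.ofReal_natCast, ENNReal.ofReal_ofNat]
        push_cast
        ring
      rw [total]
      exact (ENNReal.ofReal_le_ofReal hle).trans_eq (ENNReal.ofReal_natCast d)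
    · rw [avg_noisyInstance hM, hgrad]; exact hε

/-! ### Maxima over the tails of a finite sequence -/

/-- The maximum of `0` and the terms `a j, …, a (n - 1)`. -/
def tailMax (a : ℕ → ℝ) (n j : ℕ) : ℝ := (Finset.Ico j n).fold max 0 a

/-- The amount by which `a i` exceeds `0` and all later terms up to `a (n - 1)`, and `0` if it does
not exceed them. -/
def excess (a : ℕ → ℝ) (n i : ℕ) : ℝ := tailMax a n i - tailMax a n (i + 1)

section TailMax

variable (a b : ℕ → ℝ) {c : ℝ} {n i : ℕ}

theorem tailMax_of_lt (hi : i < n) : tailMax a n i = max (a i) (tailMax a n (i + 1)) := by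
  rw [tailMax, ← Finset.insert_Ico_succ_left_eq_Ico hi, Finset.fold_insert (by simp)]
  rfl

theorem tailMax_self (n : ℕ) : tailMax a n n = 0 := by simp [tailMax]

theorem tailMax_nonneg (n i : ℕ) : 0 ≤ tailMax a n i := (Finset.le_fold_max 0).2 (.inl le_rfl)

variable {a} in
theorem tailMax_le (hc : 0 ≤ c) (h : ∀ j ≥ i, a j ≤ c) : tailMax a n i ≤ c :=
  (Finset.fold_max_le c).2 ⟨hc, fun j hj => h j (Finset.mem_Ico.1 hj).1⟩

variable {a} in
theorem tailMax_eq_zero (h : ∀ j ≥ i, a j = 0) : tailMax a n i = 0 :=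
  le_antisymm (tailMax_le le_rfl fun j hj => (h j hj).le) (tailMax_nonneg a n i)

theorem excess_nonneg (hi : i < n) : 0 ≤ excess a n i := by
  rw [excess, tailMax_of_lt a hi]
  exact sub_nonneg.2 (le_max_right _ _)

variable {a} in
theorem sum_excess_sq_le_one (h : ∀ i, a i ≤ 1) : ∑ i ∈ Finset.range n, excess a n i ^ 2 ≤ 1 := by
  have excess_le_one (i : ℕ) : excess a n i ≤ 1 := by
    have := tailMax_nonneg a n (i + 1)
    have := tailMax_le (n := n) (i := i) zero_le_one fun j _ => h j
    unfold excess; linarith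
  calc ∑ i ∈ Finset.range n, excess a n i ^ 2
      ≤ ∑ i ∈ Finset.range n, (tailMax a n i - tailMax a n (i + 1)) :=
        Finset.sum_le_sum fun i hi => pow_le_of_le_one
          (excess_nonneg a (Finset.mem_range.1 hi)) (excess_le_one i) two_ne_zero
    _ = tailMax a n 0 := by rw [Finset.sum_range_sub', tailMax_self, sub_zero]
    _ ≤ 1 := tailMax_le zero_le_one fun j _ => h j

theorem sq_max_sub_max_add_sq_min_sub_min_le (a m b l : ℝ) :
    (max a m - max b l) ^ 2 + (min a m - min b l) ^ 2 ≤ (a - b) ^ 2 + (m - l) ^ 2 := by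
  rcases le_total a m with h | h <;> rcases le_total b l with h' | h' <;>
    simp only [max_eq_left, max_eq_right, min_eq_left, min_eq_right, h, h'] <;>
    nlinarith [mul_nonneg (sub_nonneg.2 h) (sub_nonneg.2 h')]

theorem sq_excess_sub_excess_le (hi : i < n) :
    (excess a n i - excess b n i) ^ 2 ≤ 4 * (a i - b i) ^ 2
      + 2 * ((tailMax a n (i + 1) - tailMax b n (i + 1)) ^ 2
        - (tailMax a n i - tailMax b n i) ^ 2) := by
  rw [excess, excess, tailMax_of_lt a hi, tailMax_of_lt b hi]
  set m := tailMax a n (i + 1)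
  set l := tailMax b n (i + 1)
  have excess_sub : max (a i) m - m - (max (b i) l - l)
      = (a i - b i) - (min (a i) m - min (b i) l) := by
    linarith [max_add_min (a i) m, max_add_min (b i) l]
  rw [excess_sub]
  linarith [sq_max_sub_max_add_sq_min_sub_min_le (a i) m (b i) l,
    sq_nonneg (a i - b i + (min (a i) m - min (b i) l))]

theorem sum_sq_excess_sub_excess_le (n : ℕ) :
    ∑ i ∈ Finset.range n, (excess a n i - excess b n i) ^ 2
      ≤ 4 * ∑ i ∈ Finset.range n, (a i - b i) ^ 2 := by
  refine (Finset.sum_le_sum fun i hi =>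
    sq_excess_sub_excess_le a b (Finset.mem_range.1 hi)).trans ?_
  rw [Finset.sum_add_distrib, ← Finset.mul_sum, ← Finset.mul_sum,
    Finset.sum_range_sub fun i => (tailMax a n i - tailMax b n i) ^ 2, tailMax_self, tailMax_self]
  linarith [sq_nonneg (tailMax a n 0 - tailMax b n 0)]

end TailMax

/-! ### One-dimensional building blocks -/

section BuildingBlocks

open Real

theorem hasDerivAt_smoothTransition (t : ℝ) :
    HasDerivAt smoothTransition (deriv smoothTransition t) t :=
  (smoothTransition.contDiff.differentiable one_ne_zero t).hasDerivAt

theorem contDiff_deriv_smoothTransition : ContDiff ℝ 1 (deriv smoothTransition) :=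
  (contDiff_succ_iff_deriv.1 (smoothTransition.contDiff (n := 2))).2.2

theorem deriv_smoothTransition_of_nonpos {t : ℝ} (ht : t ≤ 0) : deriv smoothTransition t = 0 :=
  IsLocalMin.deriv_eq_zero <| .of_forall fun u => by
    rw [smoothTransition.zero_of_nonpos ht]; exact smoothTransition.nonneg u

theorem deriv_smoothTransition_of_one_le {t : ℝ} (ht : 1 ≤ t) : deriv smoothTransition t = 0 :=
  IsLocalMax.deriv_eq_zero <| .of_forall fun u => by
    rw [smoothTransition.one_of_one_le ht]; exact smoothTransition.le_one u

theorem hasCompactSupport_deriv_smoothTransition : HasCompactSupport (deriv smoothTransition) :=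
  .intro (isCompact_Icc (a := 0) (b := 1)) fun t ht => by
    rcases not_and_or.1 ht with h | h
    · exact deriv_smoothTransition_of_nonpos (not_le.1 h).le
    · exact deriv_smoothTransition_of_one_le (not_le.1 h).le

theorem exists_lipschitzWith_smoothTransition :
    ∃ C, LipschitzWith C smoothTransition ∧ LipschitzWith C (deriv smoothTransition) := by
  obtain ⟨C, hC⟩ := contDiff_deriv_smoothTransition.lipschitzWith_of_hasCompactSupport
    hasCompactSupport_deriv_smoothTransition one_ne_zero
  obtain ⟨B, hB⟩ := contDiff_deriv_smoothTransition.continuous.bounded_above_of_compact_support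
    hasCompactSupport_deriv_smoothTransition
  refine ⟨max B.toNNReal C, ?_, hC.weaken (le_max_right _ _)⟩
  refine lipschitzWith_of_nnnorm_deriv_le (smoothTransition.contDiff.differentiable one_ne_zero)
    fun t => le_max_of_le_left ?_
  exact NNReal.le_toNNReal_of_coe_le (hB t)

theorem one_le_of_lipschitzWith_smoothTransition {C : NNReal}
    (hC : LipschitzWith C smoothTransition) : (1 : ℝ) ≤ C := by
  simpa [smoothTransition.one, smoothTransition.zero] using hC.dist_le_mul 1 0

/-- A penalty on negative arguments, with derivative `t ↦ -smoothTransition (-t)`. -/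
noncomputable def negPenalty (t : ℝ) : ℝ := ∫ u in (0 : ℝ)..(-t), smoothTransition u

theorem hasDerivAt_negPenalty (t : ℝ) : HasDerivAt negPenalty (-smoothTransition (-t)) t := by
  have primitive : HasDerivAt (fun v => ∫ u in (0 : ℝ)..v, smoothTransition u)
      (smoothTransition (-t)) (-t) :=
    smoothTransition.continuous.integral_hasStrictDerivAt 0 (-t) |>.hasDerivAt
  have := primitive.scomp t (hasDerivAt_neg t)
  rwa [neg_one_smul] at this

theorem negPenalty_zero : negPenalty 0 = 0 := by simp [negPenalty]

theorem negPenalty_nonneg (t : ℝ) : 0 ≤ negPenalty t := by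
  rcases le_total t 0 with ht | ht
  · exact intervalIntegral.integral_nonneg (neg_nonneg.2 ht) fun u _ => smoothTransition.nonneg u
  · refine (intervalIntegral.integral_zero_ae (.of_forall fun u hu => ?_)).ge
    rw [Set.uIoc_of_ge (neg_nonpos.2 ht)] at hu
    exact smoothTransition.zero_of_nonpos hu.2

/-- A bounded, positive and strictly increasing function. -/
noncomputable def ramp (t : ℝ) : ℝ := arctan t + 2

/-- The derivative of `ramp`. -/
noncomputable def rampDeriv (t : ℝ) : ℝ := 1 / (1 + t ^ 2)

theorem hasDerivAt_ramp (t : ℝ) : HasDerivAt ramp (rampDeriv t) t :=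
  (hasDerivAt_arctan t).add_const 2

theorem ramp_nonneg (t : ℝ) : 0 ≤ ramp t := by
  unfold ramp; linarith [neg_pi_div_two_lt_arctan t, pi_lt_four]

theorem ramp_le_four (t : ℝ) : ramp t ≤ 4 := by
  unfold ramp; linarith [arctan_lt_pi_div_two t, pi_lt_four]

theorem rampDeriv_nonneg (t : ℝ) : 0 ≤ rampDeriv t := by unfold rampDeriv; positivity

theorem rampDeriv_le_one (t : ℝ) : rampDeriv t ≤ 1 :=
  div_le_one_of_le₀ (le_add_of_nonneg_right (sq_nonneg t)) (by positivity)

theorem rampDeriv_zero : rampDeriv 0 = 1 := by simp [rampDeriv]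

theorem half_le_rampDeriv {t : ℝ} (ht : |t| ≤ 1) : 1 / 2 ≤ rampDeriv t := by
  refine one_div_le_one_div_of_le (by positivity) ?_
  linarith [(sq_le_one_iff_abs_le_one t).2 ht]

theorem hasDerivAt_rampDeriv (t : ℝ) :
    HasDerivAt rampDeriv (-(2 * t) / (1 + t ^ 2) ^ 2) t := by
  have := ((hasDerivAt_pow 2 t).const_add 1).fun_inv (by positivity)
  simp only [← one_div, Nat.cast_ofNat, Nat.add_one_sub_one, pow_one] at this
  exact this

theorem lipschitzWith_ramp : LipschitzWith 1 ramp :=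
  lipschitzWith_of_nnnorm_deriv_le (fun t => (hasDerivAt_ramp t).differentiableAt) fun t => by
    rw [(hasDerivAt_ramp t).deriv, ← NNReal.coe_le_coe, coe_nnnorm,
      norm_of_nonneg (rampDeriv_nonneg t)]
    exact rampDeriv_le_one t

theorem lipschitzWith_rampDeriv : LipschitzWith 1 rampDeriv :=
  lipschitzWith_of_nnnorm_deriv_le (fun t => (hasDerivAt_rampDeriv t).differentiableAt) fun t => by
    rw [(hasDerivAt_rampDeriv t).deriv, ← NNReal.coe_le_coe, coe_nnnorm, norm_eq_abs, abs_div,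
      abs_of_pos (by positivity : 0 < (1 + t ^ 2) ^ 2), NNReal.coe_one,
      div_le_one (by positivity), abs_le]
    constructor <;> nlinarith [sq_nonneg (t - 1), sq_nonneg (t + 1), sq_nonneg (t ^ 2)]

end BuildingBlocks

/-! ### The chain -/

section Chain

open Real

variable {d : ℕ} {C : NNReal}

/-- The coordinates of a vector as linear forms numbered from `1` to `d`; all other numbers are
assigned the zero form. -/
noncomputable def shiftedCoord (d : ℕ) : ℕ → Pt d →L[ℝ] ℝ
  | 0 => 0
  | j + 1 => if h : j < d then EuclideanSpace.proj ⟨j, h⟩ else 0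

theorem shiftedCoord_zero : shiftedCoord d 0 = 0 := rfl

theorem shiftedCoord_succ_coe (i : Fin d) (x : Pt d) : shiftedCoord d (i + 1) x = x i := by
  simp [shiftedCoord]

theorem shiftedCoord_of_lt {j : ℕ} (h : d < j) : shiftedCoord d j = 0 := by
  obtain ⟨j, rfl⟩ := Nat.exists_eq_add_of_lt h
  simp [shiftedCoord]

theorem shiftedCoord_eq_zero {k j : ℕ} {x : Pt d} (hx : coordSupport x ⊆ firstCoords d k)
    (hj : k < j) : shiftedCoord d j x = 0 := by
  rcases lt_or_ge d j with h | h
  · simp [shiftedCoord_of_lt h]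
  · obtain ⟨i, rfl⟩ := Nat.exists_eq_succ_of_ne_zero (Nat.ne_zero_of_lt hj)
    rw [Nat.succ_eq_add_one, shiftedCoord_succ_coe ⟨i, h⟩]
    exact coordSupport_subset_firstCoords_iff.1 hx _ (Nat.lt_succ_iff.1 hj)

theorem sum_sq_shiftedCoord_le (s : Finset ℕ) (x : Pt d) :
    ∑ j ∈ s, shiftedCoord d j x ^ 2 ≤ ‖x‖ ^ 2 := by
  have norm_sq_eq : ‖x‖ ^ 2 = ∑ j ∈ Finset.range (d + 1), shiftedCoord d j x ^ 2 := by
    rw [Finset.sum_range_succ', ← Fin.sum_univ_eq_sum_range fun j => shiftedCoord d (j + 1) x ^ 2,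
      EuclideanSpace.norm_sq_eq]
    simp [shiftedCoord_succ_coe, shiftedCoord_zero]
  have hrange : Finset.range (d + 1) ⊆ s ∪ Finset.range (d + 1) := Finset.subset_union_right
  rw [norm_sq_eq, Finset.sum_subset hrange fun j _ hj => ?_]
  · exact Finset.sum_le_sum_of_subset_of_nonneg Finset.subset_union_left fun _ _ _ => sq_nonneg _
  · rw [shiftedCoord_of_lt (by simpa using hj), zero_apply, zero_pow two_ne_zero]

theorem sum_range_sq_shiftedCoord_add_le (n k : ℕ) (x : Pt d) :
    ∑ j ∈ Finset.range n, shiftedCoord d (j + k) x ^ 2 ≤ ‖x‖ ^ 2 := by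
  simpa using sum_sq_shiftedCoord_le ((Finset.range n).map (addRightEmbedding k)) x

theorem norm_sq_toLp_eq_sum_range (c : ℕ → ℝ) :
    ‖(WithLp.toLp 2 fun i : Fin d => c i : Pt d)‖ ^ 2 = ∑ j ∈ Finset.range d, c j ^ 2 := by
  rw [EuclideanSpace.norm_sq_eq, ← Fin.sum_univ_eq_sum_range fun j => c j ^ 2]
  simp

theorem norm_sq_toLp_sub_toLp_eq_sum_range (a b : ℕ → ℝ) :
    ‖(WithLp.toLp 2 fun i : Fin d => a i : Pt d) - WithLp.toLp 2 fun i : Fin d => b i‖ ^ 2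
      = ∑ j ∈ Finset.range d, (a j - b j) ^ 2 :=
  norm_sq_toLp_eq_sum_range fun j => a j - b j

theorem inner_toLp_eq_sum_range (c : ℕ → ℝ) (v : Pt d) :
    inner ℝ (WithLp.toLp 2 fun i : Fin d => c i : Pt d) v
      = ∑ j ∈ Finset.range d, c j * shiftedCoord d (j + 1) v := by
  rw [← Fin.sum_univ_eq_sum_range fun j => c j * shiftedCoord d (j + 1) v, PiLp.inner_apply]
  simp [shiftedCoord_succ_coe, mul_comm]

theorem sum_range_mul_shiftedCoord (a b : ℕ → ℝ) (v : Pt d) :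
    ∑ j ∈ Finset.range (d + 1), (a j * shiftedCoord d (j + 1) v - b j * shiftedCoord d j v)
      = ∑ j ∈ Finset.range d, (a j - b (j + 1)) * shiftedCoord d (j + 1) v := by
  rw [Finset.sum_sub_distrib, Finset.sum_range_succ, shiftedCoord_of_lt (Nat.lt_succ_self d),
    Finset.sum_range_succ' (fun j => b j * shiftedCoord d j v), shiftedCoord_zero]
  simp [sub_mul]

/-- The coordinates of a vector, numbered from `1`, preceded by `1` and followed by zeros. -/
noncomputable def padded (x : Pt d) (j : ℕ) : ℝ :=
  Pi.single (M := fun _ => ℝ) 0 1 j + shiftedCoord d j x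

theorem padded_zero (x : Pt d) : padded x 0 = 1 := by simp [padded, shiftedCoord_zero]

theorem padded_eq_zero {k j : ℕ} {x : Pt d} (hx : coordSupport x ⊆ firstCoords d k)
    (hj : k < j) : padded x j = 0 := by
  simp [padded, Nat.ne_zero_of_lt hj, shiftedCoord_eq_zero hx hj]

theorem padded_sub_padded (x y : Pt d) (j : ℕ) :
    padded x j - padded y j = shiftedCoord d j (x - y) := by
  simp [padded]

theorem hasFDerivAt_padded (x : Pt d) (j : ℕ) :
    HasFDerivAt (fun y : Pt d => padded y j) (shiftedCoord d j) x :=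
  (shiftedCoord d j).hasFDerivAt.const_add _

/-- The unscaled hard function, in which the factor `smoothTransition (padded x j)` hides the
coordinate numbered `j + 1` as long as the previous one is not positive. -/
noncomputable def chainFun (x : Pt d) : ℝ :=
  ∑ j ∈ Finset.range (d + 1),
    (negPenalty (padded x (j + 1)) - smoothTransition (padded x j) * ramp (padded x (j + 1)))

/-- The partial derivatives of `chainFun` in terms of the padded coordinates. -/
noncomputable def chainPartial (X : ℕ → ℝ) (j : ℕ) : ℝ :=
  -(smoothTransition (X j) * rampDeriv (X (j + 1))
    + deriv smoothTransition (X (j + 1)) * ramp (X (j + 2)) + smoothTransition (-X (j + 1)))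

/-- The gradient of `chainFun`. -/
noncomputable def chainGrad (x : Pt d) : Pt d :=
  WithLp.toLp 2 fun i : Fin d => chainPartial (padded x) i

/-- The noise direction: the excesses of the activation levels `smoothTransition (padded x j)`. Its
first new coordinate is the one by which `chainGrad` leaves the coordinates found so far. -/
noncomputable def chainNoise (x : Pt d) : Pt d :=
  -WithLp.toLp 2 fun i : Fin d => excess (fun j => smoothTransition (padded x j)) d i

theorem hasGradientAt_chainFun (x : Pt d) : HasGradientAt chainFun (chainGrad x) x := by
  rw [hasGradientAt_iff_hasFDerivAt]
  have termwise := HasFDerivAt.fun_sum (u := Finset.range (d + 1)) (x := x) fun j _ =>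
    ((hasDerivAt_negPenalty _).comp_hasFDerivAt x (hasFDerivAt_padded x (j + 1))).sub
    (((hasDerivAt_smoothTransition _).comp_hasFDerivAt x (hasFDerivAt_padded x j)).mul
      ((hasDerivAt_ramp _).comp_hasFDerivAt x (hasFDerivAt_padded x (j + 1))))
  refine termwise.congr_fderiv ?_
  ext v
  have by_parts := sum_range_mul_shiftedCoord
    (fun j => -(smoothTransition (padded x j) * rampDeriv (padded x (j + 1)))
      - smoothTransition (-padded x (j + 1)))
    (fun j => deriv smoothTransition (padded x j) * ramp (padded x (j + 1))) v
  rw [InnerProductSpace.toDual_apply_apply, chainGrad, inner_toLp_eq_sum_range, sum_apply]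
  refine Eq.trans (Finset.sum_congr rfl fun j _ => ?_)
    (by_parts.trans (Finset.sum_congr rfl fun j _ => ?_))
  · simp only [sub_apply, add_apply, smul_apply, smul_eq_mul, Function.comp_apply]
    ring
  · rw [chainPartial]
    ring

theorem differentiable_chainGrad : Differentiable ℝ (chainGrad (d := d)) := by
  have hpadded j : Differentiable ℝ fun x : Pt d => padded x j := fun x =>
    (hasFDerivAt_padded x j).differentiableAt
  have hs : Differentiable ℝ smoothTransition := fun t =>
    (hasDerivAt_smoothTransition t).differentiableAt
  have hs' : Differentiable ℝ (deriv smoothTransition) :=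
    contDiff_deriv_smoothTransition.differentiable one_ne_zero
  have hr : Differentiable ℝ ramp := fun t => (hasDerivAt_ramp t).differentiableAt
  have hr' : Differentiable ℝ rampDeriv := fun t => (hasDerivAt_rampDeriv t).differentiableAt
  refine differentiable_euclidean.2 fun i => ?_
  exact ((((hs.comp (hpadded _)).mul (hr'.comp (hpadded _))).add
    ((hs'.comp (hpadded _)).mul (hr.comp (hpadded _)))).add (hs.comp (hpadded _).neg)).neg

theorem chainFun_zero_nonpos : chainFun (0 : Pt d) ≤ 0 := by
  refine Finset.sum_nonpos fun j _ => ?_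
  have : padded (0 : Pt d) (j + 1) = 0 := by simp [padded]
  rw [this, negPenalty_zero, zero_sub, neg_nonpos]
  exact mul_nonneg (smoothTransition.nonneg _) (ramp_nonneg 0)

theorem neg_le_chainFun (x : Pt d) : -(4 * (d + 1)) ≤ chainFun x := by
  have term (j : ℕ) : -4 ≤ negPenalty (padded x (j + 1))
      - smoothTransition (padded x j) * ramp (padded x (j + 1)) := by
    have := mul_le_mul (smoothTransition.le_one (padded x j)) (ramp_le_four (padded x (j + 1)))
      (ramp_nonneg _) zero_le_one
    linarith [negPenalty_nonneg (padded x (j + 1))]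
  have := Finset.card_nsmul_le_sum (Finset.range (d + 1)) _ (-4) fun j _ => term j
  rw [Finset.card_range, nsmul_eq_mul] at this
  push_cast at this
  exact le_of_eq_of_le (by ring) this

theorem tailMax_smoothTransition_padded_eq_zero {k i : ℕ} {x : Pt d}
    (hx : coordSupport x ⊆ firstCoords d k) (hi : k < i) :
    tailMax (fun j => smoothTransition (padded x j)) d i = 0 :=
  tailMax_eq_zero fun j hj => by
    rw [padded_eq_zero hx (hi.trans_le hj), smoothTransition.zero]

theorem chainGrad_apply_eq_zero {k : ℕ} {x : Pt d} (hx : coordSupport x ⊆ firstCoords d k)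
    {i : Fin d} (hi : k < i) : chainGrad x i = 0 := by
  simp [chainGrad, chainPartial, padded_eq_zero hx hi, padded_eq_zero hx (Nat.lt_succ_of_lt hi),
    smoothTransition.zero, deriv_smoothTransition_of_nonpos le_rfl]

theorem chainNoise_apply_eq_zero {k : ℕ} {x : Pt d} (hx : coordSupport x ⊆ firstCoords d k)
    {i : Fin d} (hi : k < i) : chainNoise x i = 0 := by
  simp [chainNoise, excess, tailMax_smoothTransition_padded_eq_zero hx hi,
    tailMax_smoothTransition_padded_eq_zero hx (Nat.lt_succ_of_lt hi)]

theorem chainGrad_apply_eq_chainNoise_apply {x : Pt d} {i : Fin d}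
    (hx : coordSupport x ⊆ firstCoords d i) : chainGrad x i = chainNoise x i := by
  have hnext : padded x (i + 1) = 0 := padded_eq_zero hx (Nat.lt_succ_self _)
  simp [chainGrad, chainPartial, chainNoise, excess, tailMax_of_lt _ i.2,
    tailMax_smoothTransition_padded_eq_zero hx (Nat.lt_succ_self _), hnext, rampDeriv_zero,
    smoothTransition.zero, deriv_smoothTransition_of_nonpos le_rfl, smoothTransition.nonneg]

theorem isNoisyChain_chain : IsNoisyChain (chainGrad (d := d)) chainNoise where
  noise k x hx := coordSupport_subset_firstCoords_iff.2 fun i hi =>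
    chainNoise_apply_eq_zero hx (Nat.lt_of_succ_le hi)
  sub k x hx := coordSupport_subset_firstCoords_iff.2 fun i hi => by
    rw [PiLp.sub_apply, sub_eq_zero]
    rcases hi.eq_or_lt with rfl | hi
    · exact chainGrad_apply_eq_chainNoise_apply hx
    · rw [chainGrad_apply_eq_zero hx hi, chainNoise_apply_eq_zero hx hi]

theorem norm_chainNoise_le_one (x : Pt d) : ‖chainNoise x‖ ≤ 1 := by
  rw [← sq_le_one_iff₀ (norm_nonneg _), chainNoise, norm_neg,
    norm_sq_toLp_eq_sum_range (excess _ d)]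
  exact sum_excess_sq_le_one fun _ => smoothTransition.le_one _

theorem half_le_neg_chainPartial {X : ℕ → ℝ} {j : ℕ} (hj : 1 ≤ X j) (hj' : X (j + 1) ≤ 1) :
    1 / 2 ≤ -chainPartial X j := by
  rw [chainPartial, neg_neg, smoothTransition.one_of_one_le hj, one_mul]
  have middle_nonneg : 0 ≤ deriv smoothTransition (X (j + 1)) * ramp (X (j + 2)) :=
    mul_nonneg smoothTransition.monotone.deriv_nonneg (ramp_nonneg _)
  rcases lt_or_ge (X (j + 1)) (-1) with hlt | hge
  · linarith [smoothTransition.one_of_one_le (x := -X (j + 1)) (by linarith),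
      rampDeriv_nonneg (X (j + 1))]
  · linarith [half_le_rampDeriv (abs_le.2 ⟨hge, hj'⟩), smoothTransition.nonneg (-X (j + 1))]

theorem quarter_le_norm_sq_chainGrad {k : ℕ} (hk : k < d) {x : Pt d}
    (hx : coordSupport x ⊆ firstCoords d k) : 1 / 4 ≤ ‖chainGrad x‖ ^ 2 := by
  classical
  obtain ⟨j, hjk, hj, hj'⟩ : ∃ j ≤ k, 1 ≤ padded x j ∧ padded x (j + 1) < 1 := by
    by_contra! h
    have ge_one (j : ℕ) (hj : j ≤ k + 1) : 1 ≤ padded x j := by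
      induction j with
      | zero => exact (padded_zero x).ge
      | succ j ih => exact h j (Nat.le_of_succ_le_succ hj) (ih (Nat.le_of_succ_le hj))
    linarith [ge_one _ le_rfl, padded_eq_zero hx (Nat.lt_succ_self k)]
  have hpartial := half_le_neg_chainPartial hj hj'.le
  calc (1 / 4 : ℝ) ≤ chainPartial (padded x) j ^ 2 := by nlinarith
    _ ≤ ∑ i ∈ Finset.range d, chainPartial (padded x) i ^ 2 :=
      Finset.single_le_sum (f := fun i => chainPartial (padded x) i ^ 2)
        (fun _ _ => sq_nonneg _) (Finset.mem_range.2 (hjk.trans_lt hk))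
    _ = ‖chainGrad x‖ ^ 2 := (norm_sq_toLp_eq_sum_range _).symm

theorem lipschitzWith_chainNoise (hs : LipschitzWith C smoothTransition) :
    LipschitzWith (2 * C) (chainNoise (d := d)) := by
  refine LipschitzWith.of_dist_le_mul fun x y => ?_
  rw [dist_eq_norm, dist_eq_norm]
  refine le_of_sq_le_sq ?_ (by positivity)
  have activation (j : ℕ) : (smoothTransition (padded x j) - smoothTransition (padded y j)) ^ 2
      ≤ C ^ 2 * shiftedCoord d j (x - y) ^ 2 := by
    have := hs.dist_le_mul (padded x j) (padded y j)
    rw [dist_eq_norm, dist_eq_norm, padded_sub_padded] at this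
    rw [← mul_pow, sq_le_sq, abs_mul, NNReal.abs_eq]
    exact this
  rw [chainNoise, chainNoise, neg_sub_neg, norm_sub_rev,
    norm_sq_toLp_sub_toLp_eq_sum_range (excess _ d) (excess _ d)]
  calc _ ≤ 4 * ∑ j ∈ Finset.range d,
        (smoothTransition (padded x j) - smoothTransition (padded y j)) ^ 2 :=
        sum_sq_excess_sub_excess_le _ _ d
    _ ≤ 4 * ∑ j ∈ Finset.range d, C ^ 2 * shiftedCoord d j (x - y) ^ 2 := by
        gcongr with j; exact activation j
    _ ≤ 4 * (C ^ 2 * ‖x - y‖ ^ 2) := by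
        rw [← Finset.mul_sum]; gcongr; exact sum_sq_shiftedCoord_le _ _
    _ = _ := by push_cast; ring

theorem abs_mul_sub_mul_le {a b a' b' A B : ℝ} (ha : |a| ≤ A) (hb : |b'| ≤ B) :
    |a * b - a' * b'| ≤ A * |b - b'| + B * |a - a'| := by
  calc |a * b - a' * b'| = |a * (b - b') + b' * (a - a')| := by ring_nf
    _ ≤ |a| * |b - b'| + |b'| * |a - a'| := by
      simpa only [abs_mul] using abs_add_le (a * (b - b')) (b' * (a - a'))
    _ ≤ A * |b - b'| + B * |a - a'| := by gcongr

theorem abs_chainPartial_sub_le (hs : LipschitzWith C smoothTransition)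
    (hs' : LipschitzWith C (deriv smoothTransition)) (X Y : ℕ → ℝ) (j : ℕ) :
    |chainPartial X j - chainPartial Y j|
      ≤ 6 * C * (|X j - Y j| + |X (j + 1) - Y (j + 1)| + |X (j + 2) - Y (j + 2)|) := by
  have hC := one_le_of_lipschitzWith_smoothTransition hs
  have hs_le (a b : ℝ) : |smoothTransition a - smoothTransition b| ≤ C * |a - b| :=
    hs.dist_le_mul a b
  have hs'_le (a b : ℝ) : |deriv smoothTransition a - deriv smoothTransition b| ≤ C * |a - b| :=
    hs'.dist_le_mul a b
  have hr_le (a b : ℝ) : |ramp a - ramp b| ≤ |a - b| := by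
    simpa [dist_eq] using lipschitzWith_ramp.dist_le_mul a b
  have hr'_le (a b : ℝ) : |rampDeriv a - rampDeriv b| ≤ |a - b| := by
    simpa [dist_eq] using lipschitzWith_rampDeriv.dist_le_mul a b
  have first : |smoothTransition (X j) * rampDeriv (X (j + 1))
      - smoothTransition (Y j) * rampDeriv (Y (j + 1))|
      ≤ 1 * |X (j + 1) - Y (j + 1)| + 1 * (C * |X j - Y j|) :=
    (abs_mul_sub_mul_le ((abs_of_nonneg (smoothTransition.nonneg _)).trans_le
      (smoothTransition.le_one _)) ((abs_of_nonneg (rampDeriv_nonneg _)).trans_le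
      (rampDeriv_le_one _))).trans (by linarith [hr'_le (X (j + 1)) (Y (j + 1)), hs_le (X j) (Y j)])
  have second : |deriv smoothTransition (X (j + 1)) * ramp (X (j + 2))
      - deriv smoothTransition (Y (j + 1)) * ramp (Y (j + 2))|
      ≤ C * |X (j + 2) - Y (j + 2)| + 4 * (C * |X (j + 1) - Y (j + 1)|) :=
    (abs_mul_sub_mul_le (norm_deriv_le_of_lipschitz hs) ((abs_of_nonneg (ramp_nonneg _)).trans_le
      (ramp_le_four _))).trans (add_le_add (mul_le_mul_of_nonneg_left (hr_le _ _) C.coe_nonneg)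
      (mul_le_mul_of_nonneg_left (hs'_le _ _) (by norm_num)))
  have third : |smoothTransition (-X (j + 1)) - smoothTransition (-Y (j + 1))|
      ≤ C * |X (j + 1) - Y (j + 1)| := by
    simpa only [neg_sub_neg, abs_sub_comm (Y (j + 1))] using hs_le (-X (j + 1)) (-Y (j + 1))
  calc |chainPartial X j - chainPartial Y j| = |_ + _ + _| := by
        rw [chainPartial, chainPartial, neg_sub_neg, abs_sub_comm, add_sub_add_comm,
          add_sub_add_comm]
    _ ≤ _ := (abs_add_three _ _ _).trans (add_le_add_three first second third)
    _ ≤ _ := by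
      nlinarith [mul_nonneg (sub_nonneg.2 hC) (abs_nonneg (X (j + 1) - Y (j + 1))),
        mul_nonneg C.coe_nonneg (abs_nonneg (X j - Y j)),
        mul_nonneg C.coe_nonneg (abs_nonneg (X (j + 1) - Y (j + 1))),
        mul_nonneg C.coe_nonneg (abs_nonneg (X (j + 2) - Y (j + 2)))]

theorem sq_chainPartial_sub_le (hs : LipschitzWith C smoothTransition)
    (hs' : LipschitzWith C (deriv smoothTransition)) (X Y : ℕ → ℝ) (j : ℕ) :
    (chainPartial X j - chainPartial Y j) ^ 2
      ≤ 108 * C ^ 2 * ((X j - Y j) ^ 2 + (X (j + 1) - Y (j + 1)) ^ 2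
        + (X (j + 2) - Y (j + 2)) ^ 2) := by
  have habs := abs_le.1 (abs_chainPartial_sub_le hs hs' X Y j)
  simp only [← sq_abs (X _ - Y _)]
  calc _ ≤ (6 * C * (|X j - Y j| + |X (j + 1) - Y (j + 1)| + |X (j + 2) - Y (j + 2)|)) ^ 2 :=
        sq_le_sq' habs.1 habs.2
    _ = 36 * C ^ 2 * (|X j - Y j| + |X (j + 1) - Y (j + 1)| + |X (j + 2) - Y (j + 2)|) ^ 2 := by
        ring
    _ ≤ 36 * C ^ 2 * (3 * (|X j - Y j| ^ 2 + |X (j + 1) - Y (j + 1)| ^ 2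
          + |X (j + 2) - Y (j + 2)| ^ 2)) := by
        gcongr
        linarith [sq_nonneg (|X j - Y j| - |X (j + 1) - Y (j + 1)|),
          sq_nonneg (|X j - Y j| - |X (j + 2) - Y (j + 2)|),
          sq_nonneg (|X (j + 1) - Y (j + 1)| - |X (j + 2) - Y (j + 2)|)]
    _ = _ := by ring

theorem lipschitzWith_chainGrad (hs : LipschitzWith C smoothTransition)
    (hs' : LipschitzWith C (deriv smoothTransition)) :
    LipschitzWith (18 * C) (chainGrad (d := d)) := by
  refine LipschitzWith.of_dist_le_mul fun x y => ?_
  rw [dist_eq_norm, dist_eq_norm]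
  refine le_of_sq_le_sq ?_ (by positivity)
  let v (j : ℕ) : ℝ := shiftedCoord d j (x - y)
  calc ‖chainGrad x - chainGrad y‖ ^ 2
      = ∑ j ∈ Finset.range d, (chainPartial (padded x) j - chainPartial (padded y) j) ^ 2 :=
        norm_sq_toLp_sub_toLp_eq_sum_range _ _
    _ ≤ ∑ j ∈ Finset.range d, 108 * C ^ 2 * (v j ^ 2 + v (j + 1) ^ 2 + v (j + 2) ^ 2) :=
        Finset.sum_le_sum fun j _ => by
          simpa only [padded_sub_padded] using sq_chainPartial_sub_le hs hs' (padded x) (padded y) j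
    _ = 108 * C ^ 2 * (∑ j ∈ Finset.range d, v (j + 0) ^ 2 + ∑ j ∈ Finset.range d, v (j + 1) ^ 2
          + ∑ j ∈ Finset.range d, v (j + 2) ^ 2) := by
        rw [← Finset.mul_sum, Finset.sum_add_distrib, Finset.sum_add_distrib]; rfl
    _ ≤ 108 * C ^ 2 * (‖x - y‖ ^ 2 + ‖x - y‖ ^ 2 + ‖x - y‖ ^ 2) := by
        gcongr <;> exact sum_range_sq_shiftedCoord_add_le d _ (x - y)
    _ = _ := by push_cast; ring

end Chain

section HardChain

variable {d : ℕ}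

/-- The properties of the unscaled chain with objective `f`, gradient `G` and noise `n` from which
the lower bound is derived. -/
structure IsHardChain (L : NNReal) (f : Pt d → ℝ) (G n : Pt d → Pt d) : Prop
    extends IsNoisyChain G n where
  hasGradientAt : ∀ x, HasGradientAt f (G x) x
  differentiable_grad : Differentiable ℝ G
  lipschitzWith_grad : LipschitzWith L G
  lipschitzWith_noise : LipschitzWith L n
  norm_noise_le_one : ∀ x, ‖n x‖ ≤ 1
  subopt_le : ∀ x, f 0 - f x ≤ 4 * (d + 1)
  quarter_le_norm_sq_grad : ∀ k < d, ∀ x, coordSupport x ⊆ firstCoords d k → 1 / 4 ≤ ‖G x‖ ^ 2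

theorem exists_isHardChain :
    ∃ L : NNReal, 1 ≤ L ∧ ∀ d, IsHardChain L (chainFun (d := d)) chainGrad chainNoise := by
  obtain ⟨C, hs, hs'⟩ := exists_lipschitzWith_smoothTransition
  have hC : 1 ≤ C := one_le_of_lipschitzWith_smoothTransition hs
  have two_le : 2 * C ≤ 18 * C := by gcongr; norm_num
  refine ⟨18 * C, one_le_mul_of_one_le_of_one_le (by norm_num) hC, fun d => ?_⟩
  exact
    { isNoisyChain_chain with
      hasGradientAt := hasGradientAt_chainFun
      differentiable_grad := differentiable_chainGrad
      lipschitzWith_grad := lipschitzWith_chainGrad hs hs'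
      lipschitzWith_noise := (lipschitzWith_chainNoise hs).weaken two_le
      norm_noise_le_one := norm_chainNoise_le_one
      subopt_le := fun x => by linarith [chainFun_zero_nonpos (d := d), neg_le_chainFun x]
      quarter_le_norm_sq_grad := fun k hk x hx => quarter_le_norm_sq_chainGrad hk hx }

theorem coordSupport_smul_subset (c : ℝ) (x : Pt d) : coordSupport (c • x) ⊆ coordSupport x :=
  fun _ hi => right_ne_zero_of_mul (a := c) hi

/-- The map with values scaled by `S` and argument scaled by `l⁻¹`: the gradient map of
`fun x => S * l * f (l⁻¹ • x)` if `G` is the one of `f`. -/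
noncomputable def rescale {E : Type*} [SMul ℝ E] (S l : ℝ) (G : E → E) (x : E) : E :=
  S • G (l⁻¹ • x)

theorem hasGradientAt_rescale {E : Type*} [NormedAddCommGroup E] [InnerProductSpace ℝ E]
    [CompleteSpace E] {f : E → ℝ} {G : E → E} (hG : ∀ x, HasGradientAt f (G x) x) (S : ℝ) {l : ℝ}
    (hl : l ≠ 0) (x : E) :
    HasGradientAt (fun y => S * l * f (l⁻¹ • y)) (rescale S l G x) x := by
  rw [hasGradientAt_iff_hasFDerivAt]
  have chain_rule := ((hG (l⁻¹ • x)).hasFDerivAt.comp x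
    ((hasFDerivAt_id x).const_smul l⁻¹)).const_mul (S * l)
  refine chain_rule.congr_fderiv ?_
  ext v
  simp [rescale]
  field_simp

theorem sq_norm_rescale_sub_rescale_le {E : Type*} [NormedAddCommGroup E] [NormedSpace ℝ E]
    {L : NNReal} {G : E → E} (hG : LipschitzWith L G) (S l : ℝ) (x y : E) :
    ‖rescale S l G x - rescale S l G y‖ ^ 2 ≤ (S * L / l) ^ 2 * ‖x - y‖ ^ 2 := by
  calc ‖rescale S l G x - rescale S l G y‖ ^ 2
      = S ^ 2 * ‖G (l⁻¹ • x) - G (l⁻¹ • y)‖ ^ 2 := by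
        rw [rescale, rescale, ← smul_sub, norm_smul, mul_pow, Real.norm_eq_abs, sq_abs]
    _ ≤ S ^ 2 * (L * ‖l⁻¹ • x - l⁻¹ • y‖) ^ 2 := by gcongr; exact hG.norm_sub_le _ _
    _ = (S * L / l) ^ 2 * ‖x - y‖ ^ 2 := by
        rw [← smul_sub, norm_smul, mul_pow, mul_pow, Real.norm_eq_abs, sq_abs]; ring

theorem isNoisyChain_rescale {G n : Pt d → Pt d} (h : IsNoisyChain G n) (S l : ℝ) :
    IsNoisyChain (rescale S l G) (rescale S l n) where
  noise k x hx := (coordSupport_smul_subset _ _).trans <|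
    h.noise k _ ((coordSupport_smul_subset _ _).trans hx)
  sub k x hx := by
    rw [rescale, rescale, ← smul_sub]
    exact (coordSupport_smul_subset _ _).trans <|
      h.sub k _ ((coordSupport_smul_subset _ _).trans hx)

theorem IsHardChain.hardInstance {M K R : ℕ} {H Δ σ τ ζ S q : ℝ} {L : NNReal} {f : Pt d → ℝ}
    {G n : Pt d → Pt d} (h : IsHardChain L f G n) (hL : 0 < L) (hM : M ≠ 0) (hd : d ≠ 0)
    (hH : 0 < H) (hτ : 0 ≤ τ) (hζ : 0 ≤ ζ) (hS : 0 < S) (hq : 0 < q) (hq' : q ≤ 1)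
    (hΔ : 4 * L * S ^ 2 * (d + 1) ≤ Δ * H * q) (hvar : (1 - q ^ 2) / q ^ 2 * S ^ 2 ≤ σ ^ 2)
    (hactive : R < d ∨ 2 * (M * K * R * q ^ 2) ≤ d) :
    HardInstance M K R H Δ σ τ ζ (S ^ 2 / 8) := by
  have : (0 : ℝ) < L := hL
  set l : ℝ := L * S / (H * q) with hl
  have l_pos : 0 < l := by positivity
  have q_sq_le : q ^ 2 ≤ 1 := pow_le_one₀ hq.le hq'
  have odds_nonneg : 0 ≤ (1 - q ^ 2) / q ^ 2 := div_nonneg (sub_nonneg.2 q_sq_le) (sq_nonneg q)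
  refine (isNoisyChain_rescale h.toIsNoisyChain S l).hardInstance
    (f := fun x => S * l * f (l⁻¹ • x)) (p := ⟨q ^ 2, sq_nonneg q, q_sq_le⟩)
    (ε := S ^ 2 * (1 / 4)) hM hd hH.le hτ hζ (Subtype.mk_lt_mk.2 (by positivity))
    (hasGradientAt_rescale h.hasGradientAt S l_pos.ne')
    ((h.differentiable_grad.comp (differentiable_id.const_smul l⁻¹)).const_smul S)
    (fun x => ?_) (fun x => ?_) (fun x y => ?_) (fun k hk x hx => ?_) hactive |>.mono
    (le_of_eq (by ring))
  · calc S * l * f (l⁻¹ • 0) - S * l * f (l⁻¹ • x)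
        ≤ S * l * (4 * (d + 1)) := by
          rw [smul_zero, ← mul_sub]; gcongr; exact h.subopt_le _
      _ = 4 * L * S ^ 2 * (d + 1) / (H * q) := by rw [hl]; ring
      _ ≤ Δ := by rw [div_le_iff₀ (by positivity)]; linarith
  · refine le_trans ?_ hvar
    rw [rescale, norm_smul, mul_pow, Real.norm_eq_abs, sq_abs]
    gcongr
    exact mul_le_of_le_one_right (sq_nonneg S)
      (pow_le_one₀ (norm_nonneg _) (h.norm_noise_le_one _))
  · calc _ ≤ (S * L / l) ^ 2 * ‖x - y‖ ^ 2
          + (1 - q ^ 2) / q ^ 2 * ((S * L / l) ^ 2 * ‖x - y‖ ^ 2) :=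
        add_le_add (sq_norm_rescale_sub_rescale_le h.lipschitzWith_grad S l x y)
          (mul_le_mul_of_nonneg_left
            (sq_norm_rescale_sub_rescale_le h.lipschitzWith_noise S l x y) odds_nonneg)
      _ = H ^ 2 * ‖x - y‖ ^ 2 := by rw [hl]; field_simp; ring
  · rw [rescale, norm_smul, mul_pow, Real.norm_eq_abs, sq_abs]
    gcongr
    exact h.quarter_le_norm_sq_grad k hk _ ((coordSupport_smul_subset _ _).trans hx)

end HardChain

/-! ### The three terms -/

section Terms

variable {M K R : ℕ} {H Δ σ τ ζ : ℝ} {L : NNReal}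

theorem hardInstance_optimization (hL : 1 ≤ L)
    (h : ∀ d, IsHardChain L (chainFun (d := d)) chainGrad chainNoise) (hM : M ≠ 0) (hR : R ≠ 0)
    (hH : 0 < H) (hΔ : 0 < Δ) (hτ : 0 ≤ τ) (hζ : 0 ≤ ζ) :
    HardInstance M K R H Δ σ τ ζ (Δ * H / R / (96 * L)) := by
  have hL' : 0 < L := zero_lt_one.trans_le hL
  have hR' : (1 : ℝ) ≤ R := Nat.one_le_cast.2 (Nat.one_le_iff_ne_zero.2 hR)
  have S_sq_pos : 0 < Δ * H / (12 * L * R) := by positivity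
  have S_sq : √(Δ * H / (12 * L * R)) ^ 2 = Δ * H / (12 * L * R) := Real.sq_sqrt S_sq_pos.le
  refine ((h (R + 1)).hardInstance (q := 1) hL' hM R.succ_ne_zero hH hτ hζ
    (Real.sqrt_pos.2 S_sq_pos) one_pos le_rfl ?_ (by simp [sq_nonneg])
    (Or.inl R.lt_succ_self)).mono (le_of_eq ?_)
  · calc 4 * L * √(Δ * H / (12 * L * R)) ^ 2 * (((R + 1 : ℕ) : ℝ) + 1)
        = Δ * H * ((R + 2) / (3 * R)) := by rw [S_sq]; push_cast; field_simp; ring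
      _ ≤ Δ * H * 1 := by gcongr; rw [div_le_one (by positivity)]; linarith
  · rw [S_sq]; field_simp; norm_num

theorem hasGradientAt_half_mul_norm_sub_sq {E : Type*} [NormedAddCommGroup E]
    [InnerProductSpace ℝ E] [CompleteSpace E] (H : ℝ) (v x : E) :
    HasGradientAt (fun y => H / 2 * ‖y - v‖ ^ 2) (H • (x - v)) x := by
  rw [hasGradientAt_iff_hasFDerivAt]
  refine ((((hasFDerivAt_id x).sub_const v).norm_sq).const_mul (H / 2)).congr_fderiv ?_
  ext w
  simp
  ring

theorem isNoisyChain_quadratic (H : ℝ) (v : Pt 1) :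
    IsNoisyChain (fun x => H • (x - v)) (fun _ => -(H • v)) where
  noise k _ _ := coordSupport_subset_firstCoords_iff.2 fun i hi => absurd i.2 (by omega)
  sub k x hx := by
    have : H • (x - v) - -(H • v) = H • x := by module
    exact this ▸ (coordSupport_smul_subset H x).trans hx

theorem hardInstance_quadratic {p : unitInterval} {v : Pt 1} (hM : M ≠ 0) (hH : 0 ≤ H)
    (hτ : 0 ≤ τ) (hζ : 0 ≤ ζ) (hp : 0 < p) (hΔ : H / 2 * ‖v‖ ^ 2 ≤ Δ)
    (hvar : (1 - p) / p * (H ^ 2 * ‖v‖ ^ 2) ≤ σ ^ 2) (hactive : 2 * (M * K * R * p : ℝ) ≤ 1) :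
    HardInstance M K R H Δ σ τ ζ (H ^ 2 * ‖v‖ ^ 2 / 2) := by
  refine (isNoisyChain_quadratic H v).hardInstance hM one_ne_zero hH hτ hζ hp
    (hasGradientAt_half_mul_norm_sub_sq H v) ((differentiable_id.sub_const v).const_smul H)
    (fun x => ?_) (fun _ => ?_) (fun x y => ?_) (fun k hk x hx => ?_)
    (Or.inr (by simpa using hactive))
  · have : 0 ≤ H / 2 * ‖x - v‖ ^ 2 := by positivity
    rw [zero_sub, norm_neg]
    linarith
  · rwa [norm_neg, norm_smul, mul_pow, Real.norm_eq_abs, sq_abs]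
  · rw [← smul_sub, sub_sub_sub_cancel_right, norm_smul, mul_pow, Real.norm_eq_abs, sq_abs]
    simp
  · have hx0 : x = 0 := by
      ext i
      exact coordSupport_subset_firstCoords_iff.1 hx i (by omega)
    rw [hx0, zero_sub, norm_smul, norm_neg, mul_pow, Real.norm_eq_abs, sq_abs]

theorem hardInstance_variance (hM : M ≠ 0) (hK : K ≠ 0) (hR : R ≠ 0) (hH : 0 < H) (hτ : 0 ≤ τ)
    (hζ : 0 ≤ ζ) (hσ : σ ^ 2 ≤ (M * K * R : ℝ) * (Δ * H)) :
    HardInstance M K R H Δ σ τ ζ (σ ^ 2 / (M * K * R) / 4) := by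
  have hN : (1 : ℝ) ≤ M * K * R := by
    exact_mod_cast Nat.one_le_iff_ne_zero.2 (mul_ne_zero (mul_ne_zero hM hK) hR)
  set N : ℝ := M * K * R with hN_def
  have p_nonneg : 0 ≤ 1 / (2 * N) := by positivity
  have p_le : 1 / (2 * N) ≤ 1 := by rw [div_le_one (by positivity)]; linarith
  let v : Pt 1 := EuclideanSpace.single 0 (√(σ ^ 2 / (2 * N)) / H)
  have norm_v : H ^ 2 * ‖v‖ ^ 2 = σ ^ 2 / (2 * N) := by
    rw [PiLp.norm_single, Real.norm_eq_abs, sq_abs, ← mul_pow, mul_div_cancel₀ _ hH.ne',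
      Real.sq_sqrt (by positivity)]
  refine (hardInstance_quadratic (p := ⟨1 / (2 * N), p_nonneg, p_le⟩) (v := v) hM hH.le hτ hζ
    (Subtype.mk_lt_mk.2 (by positivity)) ?_ ?_ ?_).mono (le_of_eq (by rw [norm_v]; ring))
  · refine le_of_mul_le_mul_left ?_ hH
    calc H * (H / 2 * ‖v‖ ^ 2) = σ ^ 2 / (4 * N) := by linear_combination norm_v / 2
      _ ≤ H * Δ := by rw [div_le_iff₀ (by positivity)]; nlinarith [sq_nonneg σ]
  · calc (1 - 1 / (2 * N)) / (1 / (2 * N)) * (H ^ 2 * ‖v‖ ^ 2)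
        = (1 - 1 / (2 * N)) * σ ^ 2 := by rw [norm_v]; field_simp
      _ ≤ σ ^ 2 := mul_le_of_le_one_left (sq_nonneg σ) (by linarith)
  · rw [← hN_def]
    refine le_of_eq ?_
    field_simp

theorem hardInstance_mixed_of_pow_three_eq {u : ℝ} (hL : 1 ≤ L)
    (h : ∀ d, IsHardChain L (chainFun (d := d)) chainGrad chainNoise) (hM : M ≠ 0)
    (hH : 0 < H) (hτ : 0 ≤ τ) (hζ : 0 ≤ ζ) (hσ : 0 < σ) (hu : 0 < u)
    (hu_cube : (M * K * R : ℝ) * u ^ 3 = σ * Δ * H) (hu_le : u ≤ σ)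
    (hσ_le : σ ^ 2 ≤ (M * K * R : ℝ) * u ^ 2) :
    HardInstance M K R H Δ σ τ ζ (u ^ 2 / (2048 * L ^ 2)) := by
  have : (1 : ℝ) ≤ L := hL
  set N : ℝ := M * K * R
  set κ : ℝ := 1 / (16 * L) with hκ
  have κ_pos : 0 < κ := by positivity
  have κ_le : κ ≤ 1 := by rw [hκ, div_le_one (by positivity)]; linarith
  set e : ℝ := N * u ^ 2 / σ ^ 2 with he
  have one_le_e : 1 ≤ e := (one_le_div (by positivity)).2 hσ_le
  set q : ℝ := κ * u / σ with hq
  have q_le : q ≤ 1 := by rw [hq, div_le_one hσ]; nlinarith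
  have Nq_sq : N * q ^ 2 = κ ^ 2 * e := by rw [hq, he]; ring
  have Nq_sq_pos : 0 < N * q ^ 2 := by rw [Nq_sq]; positivity
  have ceil_add_one_le : (⌈2 * (N * q ^ 2)⌉₊ : ℝ) + 1 ≤ 4 * e := by
    have := Nat.ceil_lt_add_one (mul_pos two_pos Nq_sq_pos).le
    have : N * q ^ 2 ≤ e :=
      Nq_sq.trans_le (mul_le_of_le_one_left (by linarith) (pow_le_one₀ κ_pos.le κ_le))
    linarith
  refine ((h ⌈2 * (N * q ^ 2)⌉₊).hardInstance (S := κ * u) (q := q) (zero_lt_one.trans_le hL) hM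
    (Nat.ceil_pos.2 (by positivity)).ne' hH hτ hζ (by positivity) (by positivity) q_le ?_ ?_
    (Or.inr (Nat.le_ceil _))).mono (le_of_eq ?_)
  · calc 4 * L * (κ * u) ^ 2 * (⌈2 * (N * q ^ 2)⌉₊ + 1) ≤ 4 * L * (κ * u) ^ 2 * (4 * e) := by gcongr
      _ = 16 * L * κ * (κ * u) * (N * u ^ 3) / σ ^ 2 := by rw [he]; ring
      _ = Δ * H * q := by rw [hu_cube, hq, hκ]; field_simp
  · calc (1 - q ^ 2) / q ^ 2 * (κ * u) ^ 2 = (1 - q ^ 2) * σ ^ 2 := by rw [hq]; field_simp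
      _ ≤ σ ^ 2 := mul_le_of_le_one_left (sq_nonneg σ) (by linarith [sq_nonneg q])
  · rw [hκ]; field_simp; norm_num

theorem hardInstance_mixed (hL : 1 ≤ L)
    (h : ∀ d, IsHardChain L (chainFun (d := d)) chainGrad chainNoise) (hM : M ≠ 0) (hK : K ≠ 0)
    (hR : R ≠ 0) (hH : 0 < H) (hΔ : 0 < Δ) (hσ : 0 ≤ σ) (hτ : 0 ≤ τ) (hζ : 0 ≤ ζ)
    (optimization_le : Δ * H / R ≤ (σ * Δ * H / (M * K * R)) ^ (2 / 3 : ℝ))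
    (variance_le : σ ^ 2 / (M * K * R) ≤ (σ * Δ * H / (M * K * R)) ^ (2 / 3 : ℝ)) :
    HardInstance M K R H Δ σ τ ζ
      ((σ * Δ * H / (M * K * R)) ^ (2 / 3 : ℝ) / (2048 * L ^ 2)) := by
  have hR' : (0 : ℝ) < R := by exact_mod_cast Nat.pos_of_ne_zero hR
  have hMK : (1 : ℝ) ≤ M * K := by exact_mod_cast Nat.one_le_iff_ne_zero.2 (mul_ne_zero hM hK)
  have N_pos : (0 : ℝ) < M * K * R := by positivity
  set x := σ * Δ * H / (M * K * R) with hx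
  have x_nonneg : 0 ≤ x := by positivity
  set u := x ^ (1 / 3 : ℝ) with hu
  have u_sq : x ^ (2 / 3 : ℝ) = u ^ 2 := by
    rw [hu, ← Real.rpow_natCast, ← Real.rpow_mul x_nonneg]; norm_num
  have u_cube : (M * K * R : ℝ) * u ^ 3 = σ * Δ * H := by
    rw [hu, ← Real.rpow_natCast, ← Real.rpow_mul x_nonneg, hx]; norm_num; field_simp
  rw [u_sq] at optimization_le variance_le ⊢
  rw [div_le_iff₀ hR'] at optimization_le
  rw [div_le_iff₀ N_pos] at variance_le
  have u_pos : 0 < u := by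
    refine lt_of_le_of_ne (Real.rpow_nonneg x_nonneg _) fun h0 => ?_
    rw [← h0] at optimization_le
    linarith [mul_pos hΔ hH]
  have u_le : u ≤ σ := by
    refine le_of_mul_le_mul_right (a := R * u ^ 2) ?_ (by positivity)
    calc u * (R * u ^ 2) ≤ M * K * (u * (R * u ^ 2)) := le_mul_of_one_le_left (by positivity) hMK
      _ = σ * (Δ * H) := by linear_combination u_cube
      _ ≤ σ * (R * u ^ 2) := mul_le_mul_of_nonneg_left (by linarith) hσ
  exact hardInstance_mixed_of_pow_three_eq hL h hM hH hτ hζ (u_pos.trans_le u_le) u_pos u_cube u_le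
    (by linarith)

end Terms

theorem div_mul_add_add_le {a b c t C D : ℝ} (ha : a ≤ t) (hb : b ≤ t) (hc : c ≤ t) (ht : 0 ≤ t)
    (hD : 0 < D) (hDC : D ≤ C) : 1 / (3 * C) * (a + b + c) ≤ t / D := by
  have hC : 0 < C := hD.trans_le hDC
  calc 1 / (3 * C) * (a + b + c) ≤ 1 / (3 * C) * (3 * t) := by gcongr; linarith
    _ = t / C := by field_simp
    _ ≤ t / D := by gcongr

theorem mainTheorem10 :
    ∃ c : ℝ, 0 < c ∧
      ∀ (M K R : ℕ) (H Δ σ τ ζ : ℝ), 0 < M → 0 < K → 0 < R →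
        0 < H → 0 < Δ → 0 ≤ σ → 0 ≤ τ → 0 ≤ ζ →
        σ ^ 2 ≤ (M * K * R : ℝ) * (Δ * H) →
        ∃ (d : ℕ) (P : ProblemInstance d M),
          P.Smooth H ∧ P.BoundedSubopt Δ ∧ P.BoundedSecondHet τ ∧ P.BoundedFirstHet H ζ ∧
          P.OracleConditions H σ ∧
          ∀ (Ω : Type) [MeasurableSpace Ω] (μ : Measure Ω) [IsProbabilityMeasure μ]
            (A : DistAlgorithm d M Ω), A.ZeroRespecting → A.Centralized →
            ENNReal.ofReal (c * (Δ * H / R + σ ^ 2 / (M * K * R)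
                + (σ * Δ * H / (M * K * R)) ^ (2 / 3 : ℝ)))
              ≤ A.expectedSqGrad μ P K R := by
  obtain ⟨L, hL, hchain⟩ := exists_isHardChain
  have : (1 : ℝ) ≤ L := hL
  refine ⟨1 / (3 * (2048 * L ^ 2)), by positivity, ?_⟩
  intro M K R H Δ σ τ ζ hM hK hR hH hΔ hσ hτ hζ hσ_sq
  change HardInstance M K R H Δ σ τ ζ _
  set optimization := Δ * H / R
  set variance := σ ^ 2 / (M * K * R)
  set mixed := (σ * Δ * H / (M * K * R)) ^ (2 / 3 : ℝ)
  obtain ⟨h₁, h₂⟩ | ⟨h₁, h₂⟩ | ⟨h₁, h₂⟩ :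
      (variance ≤ optimization ∧ mixed ≤ optimization) ∨
      (optimization ≤ variance ∧ mixed ≤ variance) ∨
      (optimization ≤ mixed ∧ variance ≤ mixed) := by grind
  · exact (hardInstance_optimization hL hchain hM.ne' hR.ne' hH hΔ hτ hζ).mono
      (div_mul_add_add_le le_rfl h₁ h₂ (by positivity) (by positivity) (by nlinarith))
  · exact (hardInstance_variance hM.ne' hK.ne' hR.ne' hH hτ hζ hσ_sq).mono
      (div_mul_add_add_le h₁ le_rfl h₂ (by positivity) (by positivity) (by nlinarith))
  · exact (hardInstance_mixed hL hchain hM.ne' hK.ne' hR.ne' hH hΔ hσ hτ hζ h₁ h₂).mono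
      (div_mul_add_add_le h₁ h₂ le_rfl (by positivity) (by positivity) le_rfl)
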